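/- **Setting.** Let $H$ be a complex Hilbert space, $\mathbb D=\{|z|<1\}$, $\mathbb T=\{|z|=1\}$, and let $V$ be a closed isometric operator in $H$, with domain $D(V)\subseteq H$ (a linear subspace, not necessarily dense). For $\zeta\in\mathbb C$ put $M_\zeta=(E_H-\zeta V)D(V)$ and $N_\zeta=H\ominus M_\zeta$. For $z\in\mathbb D$ put $V_z=(V-\bar z E_H)(E_H-zV)^{-1}$, an isometric operator with domain $M_z$. For $z_0\in\mathbb D\setminus\{0\}$ and a bounded linear operator $C:N_{z_0}\to N_{1/\bar z_0}$ put $V^+_{z_0;C}=V_{z_0}\oplus C$, and define the orthogonal extension of $V$ determined by $C$ as $$V_{C;z_0}=(V^+_{z_0;C}+\bar z_0E_H)(E_H+z_0V^+_{z_0;C})^{-1}.$$ Let $U$ be a unitary operator in a Hilbert space $\widetilde H\supseteq H$ that extends $V$, and let $\mathbf R_\zeta=P_H(E_{\widetilde H}-\zeta U)^{-1}|_H$ $(|\zeta|\ne1)$ be the corresponding generalized resolvent of $V$. For $z_0\in\mathbb D\setminus\{0\}$, a function $C(\cdot\,;z_0)$ on $\mathbb D$, analytic in the operator norm, whose values are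 linear contractions $N_{z_0}\to N_{1/\bar z_0}$, is said to correspond to $\mathbf R$ by Inin's formula if $$\mathbf R_\zeta=\left[E_H-\zeta V_{C(\zeta;z_0);z_0}\right]^{-1}\qquad\text{for all }\zeta\in\mathbb D .$$ **Theorem.** Let $\lambda_k\in\mathbb D$ $(k\ge 1)$ with $\lambda_k\to\widehat\lambda\in\mathbb T$. Suppose that for some $z_0\in\mathbb D\setminus\{0\}$ the function $C(\cdot\,;z_0)$ corresponding to $\mathbf R$ by Inin's formula is such that $C(\lambda_k;z_0)$ converges in the operator norm, with limit $C(\widehat\lambda;z_0)$. Then for every $z_0'\in\mathbb D\setminus\{0\}$ there is a function $C(\cdot\,;z_0')$ corresponding to $\mathbf R$ by Inin's formula, and for any such function $C(\lambda_k;z_0')$ converges in the operator norm; its limit $C(\widehat\lambda;z_0')$ is a linear contraction from $N_{z_0'}$ into $N_{1/\bar z_0'}$, and $$V_{C(\widehat\lambda;z_0');z_0'}=V_{C(\widehat\lambda;z_0);z_0},$$ so that the limiting orthogonal extension does not depend on $z_0'$. -/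

import Mathlib

open Filter Topology

open scoped ComplexConjugate

noncomputable section

namespace IsometricOp

variable {H : Type*} [NormedAddCommGroup H] [InnerProductSpace ℂ H]

/-- The identity operator `E` of `H`, as an operator with domain `H`. -/
def idOp : H →ₗ.[ℂ] H := (LinearMap.id : H →ₗ[ℂ] H).toPMap ⊤

/-- The product `B A` of two operators with domains in `H`:
its domain is `{x ∈ D(A) : A x ∈ D(B)}`, and `(B A) x = B (A x)`. -/
def mulOp (B A : H →ₗ.[ℂ] H) : H →ₗ.[ℂ] H :=
  B.comp (A.domRestrict ((B.domain.comap A.toFun).map A.domain.subtype)) (by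
    rintro ⟨x, ⟨y, hy, rfl⟩, hx⟩
    exact hy)

/-- `V` is isometric: `‖V x‖ = ‖x‖` on the domain of `V` (any subspace, not necessarily dense). -/
def IsIsometric (V : H →ₗ.[ℂ] H) : Prop := ∀ x : V.domain, ‖V x‖ = ‖(x : H)‖

/-- `M_ζ(V) = (E - ζ V) D(V)`. -/
def rangeSpace (V : H →ₗ.[ℂ] H) (ζ : ℂ) : Submodule ℂ H :=
  LinearMap.range (idOp - ζ • V).toFun

/-- `N_ζ(V) = H ⊖ M_ζ(V)`. -/
def defectSpace (V : H →ₗ.[ℂ] H) (ζ : ℂ) : Submodule ℂ H := (rangeSpace V ζ)ᗮ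

/-- The type of bounded linear operators defined on `N_{z₀}` with values in `N_{1 / z̄₀}`
(used only for `z₀ ≠ 0`), with the operator norm. -/
abbrev Param (V : H →ₗ.[ℂ] H) (z₀ : ℂ) : Type _ :=
  defectSpace V z₀ →L[ℂ] defectSpace V (1 / conj z₀)

/-- `V_z = (V - z̄ E) (E - z V)⁻¹`. -/
def mobius (V : H →ₗ.[ℂ] H) (z : ℂ) : H →ₗ.[ℂ] H :=
  mulOp (V - conj z • idOp) (idOp - z • V).inverse

/-- A bounded operator `C : N_{z₀} → N_{1 / z̄₀}` regarded as an operator in `H` with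
domain `N_{z₀}`. -/
def paramOp {V : H →ₗ.[ℂ] H} {z₀ : ℂ} (C : Param V z₀) : H →ₗ.[ℂ] H where
  domain := defectSpace V z₀
  toFun := (defectSpace V (1 / conj z₀)).subtype ∘ₗ (C : defectSpace V z₀ →ₗ[ℂ] _)

/-- `V⁺_{z₀;C} = V_{z₀} ⊕ C`, the operator `x + y ↦ V_{z₀} x + C y` for
`x ∈ D(V_{z₀}) = M_{z₀}` and `y ∈ N_{z₀}`; its graph is the sum of the two graphs. -/
def plusOp {V : H →ₗ.[ℂ] H} {z₀ : ℂ} (C : Param V z₀) : H →ₗ.[ℂ] H :=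
  ((mobius V z₀).graph ⊔ (paramOp C).graph).toLinearPMap

/-- The orthogonal extension of `V` defined by `C`:
`V_{C;z₀} = (V⁺_{z₀;C} + z̄₀ E) (E + z₀ V⁺_{z₀;C})⁻¹`. -/
def orthogonalExtension {V : H →ₗ.[ℂ] H} {z₀ : ℂ} (C : Param V z₀) : H →ₗ.[ℂ] H :=
  mulOp (plusOp C + conj z₀ • idOp) (idOp + z₀ • plusOp C).inverse

/-- The class `𝒮(N_{z₀}; N_{1 / z̄₀})`: functions analytic in the open unit disc (for the operator
norm) whose values there are contractions from `N_{z₀}` into `N_{1 / z̄₀}`. Values outside the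
disc are irrelevant. -/
def IsSchur {V : H →ₗ.[ℂ] H} {z₀ : ℂ} (C : ℂ → Param V z₀) : Prop :=
  AnalyticOnNhd ℂ C (Metric.ball 0 1) ∧ ∀ ζ ∈ Metric.ball (0 : ℂ) 1, ‖C ζ‖ ≤ 1

/-- For a unitary operator `U` in a Hilbert space `K` and an isometric embedding `J : H → K`
(so that `J†` is the orthogonal projection of `K` onto `H`), the function
`ζ ↦ P_H (E_K - ζ U)⁻¹ |_H`, `|ζ| ≠ 1`. -/
def generalizedResolvent {K : Type*} [NormedAddCommGroup K] [InnerProductSpace ℂ K]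
    [CompleteSpace H] [CompleteSpace K] (J : H →ₗᵢ[ℂ] K) (U : K ≃ₗᵢ[ℂ] K) (ζ : ℂ) : H →L[ℂ] H :=
  (ContinuousLinearMap.adjoint J.toContinuousLinearMap) ∘L
    (Ring.inverse (1 - ζ • (U.toContinuousLinearEquiv : K →L[ℂ] K))) ∘L
    J.toContinuousLinearMap

/-- `C = C(·; z₀)` is the function of class `𝒮(N_{z₀}; N_{1 / z̄₀})` that corresponds to `R` by
Inin's formula: `R_ζ = [E - ζ V_{C(ζ);z₀}]⁻¹` for all `ζ` in the open unit disc. -/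
def IsIninParameter (V : H →ₗ.[ℂ] H) (R : ℂ → H →L[ℂ] H) (z₀ : ℂ) (C : ℂ → Param V z₀) : Prop :=
  IsSchur C ∧ ∀ ζ ∈ Metric.ball (0 : ℂ) 1,
    (R ζ : H →ₗ[ℂ] H).toPMap ⊤ = (idOp - ζ • orthogonalExtension (C ζ)).inverse

end IsometricOp

end

namespace IsometricOp

/-! ### Calculus of partially defined operators through their graphs -/

section Graph

variable {H : Type*} [NormedAddCommGroup H] [InnerProductSpace ℂ H]

/-! The contractive orthogonal extensions of `V` form a set that does not depend on the base point:
for every `z ≠ 0` in the disc, `C ↦ V_{C;z}` is a bijection from contractions `N_z → N_{1/z̄}` onto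
everywhere defined contractions `T` extending `V`. The inverse `paramOf` takes the Möbius transform
of `T` and compresses it to `N_z → N_{1/z̄}` (`extensionCLM_paramOf`, `paramOf_extensionCLM`). Both
maps are norm analytic at contractions.

Hence passing through `T` changes `z₀` into `z₁`: `paramOf V z₁ ∘ extensionCLM ∘ C` is an Inin
parameter at `z₁`, and it converges along `lam` with an unchanged limiting extension. For `ζ ≠ 0`
the resolvent determines `T` (`inin_injective`), so any other parameter at `z₁` agrees with this one
there. -/

theorem mem_graph_mulOp (B A : H →ₗ.[ℂ] H) (a c : H) :
    (a, c) ∈ (mulOp B A).graph ↔ ∃ b, (a, b) ∈ A.graph ∧ (b, c) ∈ B.graph := by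
  constructor
  · intro h
    obtain ⟨x, hx, hc⟩ := (LinearPMap.mem_graph_iff _).1 h
    obtain ⟨⟨y, hy, hyx⟩, hxA⟩ := x.2
    refine ⟨A y, ?_, ?_⟩
    · have : (y : H) = a := hyx.trans hx
      rw [← this]
      exact A.mem_graph y
    · rw [LinearPMap.mem_graph_iff]
      refine ⟨⟨A y, hy⟩, rfl, ?_⟩
      rw [← hc]
      change B _ = B _
      congr 1
      apply Subtype.ext
      change A y = A _
      congr 1
      exact Subtype.ext hyx
  · rintro ⟨b, hab, hbc⟩
    obtain ⟨x, rfl, rfl⟩ := (LinearPMap.mem_graph_iff _).1 hab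
    obtain ⟨y, hy, rfl⟩ := (LinearPMap.mem_graph_iff _).1 hbc
    have hyx : A x ∈ B.domain := by
      rw [← show (y : H) = A x from hy]
      exact y.2
    rw [LinearPMap.mem_graph_iff]
    refine ⟨⟨x, ⟨x, hyx, rfl⟩, x.2⟩, rfl, ?_⟩
    change B _ = B _
    congr 1
    exact Subtype.ext hy.symm

theorem mem_graph_inverse {f : H →ₗ.[ℂ] H} (hf : LinearMap.ker f.toFun = ⊥) (a b : H) :
    (a, b) ∈ f.inverse.graph ↔ (b, a) ∈ f.graph := by
  rw [LinearPMap.inverse_graph hf]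
  simp

theorem mem_graph_toPMap_top (A : H →L[ℂ] H) (a b : H) :
    (a, b) ∈ ((A : H →ₗ[ℂ] H).toPMap ⊤).graph ↔ A a = b := by
  simp [LinearPMap.mem_graph_iff]

theorem toPMap_top_injective {A B : H →L[ℂ] H}
    (h : (A : H →ₗ[ℂ] H).toPMap ⊤ = (B : H →ₗ[ℂ] H).toPMap ⊤) : A = B := by
  ext x
  have := (mem_graph_toPMap_top A x (A x)).2 rfl
  rw [h, mem_graph_toPMap_top] at this
  exact this.symm

theorem eq_toPMap_top {f : H →ₗ.[ℂ] H} {A : H →L[ℂ] H} (hd : f.domain = ⊤)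
    (h : ∀ x : f.domain, f x = A x) : f = (A : H →ₗ[ℂ] H).toPMap ⊤ :=
  LinearPMap.ext hd fun x _ _ => h ⟨x, _⟩

theorem toPMap_top_add_smul_idOp (A : H →L[ℂ] H) (c : ℂ) :
    (A : H →ₗ[ℂ] H).toPMap ⊤ + c • idOp = ((A + c • 1 : H →L[ℂ] H) : H →ₗ[ℂ] H).toPMap ⊤ :=
  eq_toPMap_top (by simp [idOp, LinearPMap.add_domain]) fun _ => rfl

theorem idOp_add_smul_toPMap_top (A : H →L[ℂ] H) (c : ℂ) :
    idOp + c • (A : H →ₗ[ℂ] H).toPMap ⊤ = ((1 + c • A : H →L[ℂ] H) : H →ₗ[ℂ] H).toPMap ⊤ :=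
  eq_toPMap_top (by simp [idOp, LinearPMap.add_domain]) fun _ => rfl

theorem idOp_sub_smul_toPMap_top (A : H →L[ℂ] H) (c : ℂ) :
    idOp - c • (A : H →ₗ[ℂ] H).toPMap ⊤ = ((1 - c • A : H →L[ℂ] H) : H →ₗ[ℂ] H).toPMap ⊤ :=
  eq_toPMap_top (by simp [idOp, LinearPMap.sub_domain]) fun _ => rfl

theorem mulOp_toPMap_top (A B : H →L[ℂ] H) :
    mulOp ((A : H →ₗ[ℂ] H).toPMap ⊤) ((B : H →ₗ[ℂ] H).toPMap ⊤) =
      ((A * B : H →L[ℂ] H) : H →ₗ[ℂ] H).toPMap ⊤ := by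
  apply LinearPMap.eq_of_eq_graph
  ext ⟨a, b⟩
  rw [mem_graph_mulOp, mem_graph_toPMap_top]
  simp

theorem inverse_toPMap_top {A : H →L[ℂ] H} (hA : IsUnit A) :
    ((A : H →ₗ[ℂ] H).toPMap ⊤).inverse = ((Ring.inverse A : H →L[ℂ] H) : H →ₗ[ℂ] H).toPMap ⊤ := by
  have h1 : ∀ x, Ring.inverse A (A x) = x := fun x =>
    congrArg (fun B : H →L[ℂ] H => B x) (Ring.inverse_mul_cancel A hA)
  have h2 : ∀ x, A (Ring.inverse A x) = x := fun x =>
    congrArg (fun B : H →L[ℂ] H => B x) (Ring.mul_inverse_cancel A hA)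
  apply LinearPMap.eq_of_eq_graph
  ext ⟨a, b⟩
  rw [mem_graph_inverse, mem_graph_toPMap_top, mem_graph_toPMap_top]
  · constructor
    · rintro rfl
      exact h1 b
    · rintro rfl
      exact h2 a
  · rw [LinearMap.ker_eq_bot']
    intro x hx
    apply Subtype.ext
    have hx' : A x = 0 := hx
    rw [← h1 x, hx', map_zero]
    rfl

end Graph

/-! ### Operator Möbius transformations of contractions -/

section Mobius

variable {H : Type*} [NormedAddCommGroup H] [InnerProductSpace ℂ H]

/-- The operator Möbius transformation `A ↦ (A - z̄) (1 - z A)⁻¹`. -/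
noncomputable def opMobius (z : ℂ) (A : H →L[ℂ] H) : H →L[ℂ] H :=
  (A - conj z • 1) * Ring.inverse (1 - z • A)

theorem norm_smul_lt_one {z : ℂ} (hz : ‖z‖ < 1) {A : H →L[ℂ] H} (hA : ‖A‖ ≤ 1) :
    ‖z • A‖ < 1 := by
  rw [norm_smul]
  exact (mul_le_of_le_one_right (norm_nonneg z) hA).trans_lt hz

/-- The two cross terms have the same real part. With `y = A x` this makes the Möbius transform of a
contraction contractive, and that of an isometry isometric. -/
theorem norm_sub_conj_smul_sq (z : ℂ) (x y : H) :
    ‖y - conj z • x‖ ^ 2 = ‖x - z • y‖ ^ 2 - (1 - ‖z‖ ^ 2) * (‖x‖ ^ 2 - ‖y‖ ^ 2) := by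
  have h : RCLike.re (inner ℂ y (conj z • x)) = RCLike.re (inner ℂ x (z • y)) := by
    rw [inner_smul_right, inner_smul_right, ← inner_conj_symm y x, ← map_mul, RCLike.conj_re]
  rw [norm_sub_sq (𝕜 := ℂ), norm_sub_sq (𝕜 := ℂ), h, norm_smul, norm_smul, RCLike.norm_conj]
  ring

variable [CompleteSpace H]

theorem isUnit_one_sub_smul {z : ℂ} (hz : ‖z‖ < 1) {A : H →L[ℂ] H} (hA : ‖A‖ ≤ 1) :
    IsUnit (1 - z • A) :=
  isUnit_one_sub_of_norm_lt_one (norm_smul_lt_one hz hA)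

theorem opMobius_apply_sub {z : ℂ} (hz : ‖z‖ < 1) {A : H →L[ℂ] H} (hA : ‖A‖ ≤ 1) (x : H) :
    opMobius z A (x - z • A x) = A x - conj z • x := by
  have h : opMobius z A * (1 - z • A) = A - conj z • 1 :=
    Ring.inverse_mul_cancel_right _ _ (isUnit_one_sub_smul hz hA)
  exact congrArg (fun B : H →L[ℂ] H => B x) h

theorem exists_sub_smul_eq {z : ℂ} (hz : ‖z‖ < 1) {A : H →L[ℂ] H} (hA : ‖A‖ ≤ 1) (y : H) :
    ∃ x, x - z • A x = y :=
  ⟨Ring.inverse (1 - z • A) y, congrArg (fun B : H →L[ℂ] H => B y)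
    (Ring.mul_inverse_cancel _ (isUnit_one_sub_smul hz hA))⟩

theorem norm_opMobius_le {z : ℂ} (hz : ‖z‖ < 1) {A : H →L[ℂ] H} (hA : ‖A‖ ≤ 1) :
    ‖opMobius z A‖ ≤ 1 := by
  refine ContinuousLinearMap.opNorm_le_bound _ zero_le_one fun y => ?_
  obtain ⟨x, rfl⟩ := exists_sub_smul_eq hz hA y
  rw [opMobius_apply_sub hz hA, one_mul, ← sq_le_sq₀ (norm_nonneg _) (norm_nonneg _),
    norm_sub_conj_smul_sq]
  have h1 : ‖A x‖ ^ 2 ≤ ‖x‖ ^ 2 := by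
    have := A.le_of_opNorm_le hA x
    rw [one_mul] at this
    gcongr
  have h2 : ‖z‖ ^ 2 ≤ 1 := pow_le_one₀ (norm_nonneg z) hz.le
  nlinarith [mul_nonneg (sub_nonneg.2 h2) (sub_nonneg.2 h1)]

theorem one_sub_conj_mul_self_ne_zero {z : ℂ} (hz : ‖z‖ < 1) : 1 - z * conj z ≠ 0 := by
  rw [Complex.mul_conj, Complex.normSq_eq_norm_sq]
  norm_cast
  nlinarith [norm_nonneg z]

/-- Writing the argument as `x - z A x` and applying the two transforms in turn, the final argument
is `(1 - |z|²) x` and the final value `(1 - |z|²) A x`. -/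
theorem opMobius_neg_opMobius {z : ℂ} (hz : ‖z‖ < 1) {A : H →L[ℂ] H} (hA : ‖A‖ ≤ 1) :
    opMobius (-z) (opMobius z A) = A := by
  have hB := norm_opMobius_le hz hA
  have hz' : ‖-z‖ < 1 := by rwa [norm_neg]
  ext w
  obtain ⟨y, rfl⟩ := exists_sub_smul_eq hz' hB w
  rw [opMobius_apply_sub hz' hB]
  obtain ⟨x, rfl⟩ := exists_sub_smul_eq hz hA y
  rw [opMobius_apply_sub hz hA]
  simp only [map_neg, map_sub, map_smul]
  module

theorem opMobius_opMobius_neg {z : ℂ} (hz : ‖z‖ < 1) {A : H →L[ℂ] H} (hA : ‖A‖ ≤ 1) :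
    opMobius z (opMobius (-z) A) = A := by
  simpa using opMobius_neg_opMobius (z := -z) (by rwa [norm_neg]) hA

theorem analyticAt_opMobius {z : ℂ} (hz : ‖z‖ < 1) {A : H →L[ℂ] H} (hA : ‖A‖ ≤ 1) :
    AnalyticAt ℂ (opMobius z) A := by
  have h1 : AnalyticAt ℂ (fun B : H →L[ℂ] H => 1 - z • B) A := by fun_prop
  have h2 : AnalyticAt ℂ (fun B : H →L[ℂ] H => B - conj z • 1) A := by fun_prop
  obtain ⟨u, hu⟩ := isUnit_one_sub_smul hz hA
  have h3 : AnalyticAt ℂ (Ring.inverse : (H →L[ℂ] H) → _) (1 - z • A) := by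
    rw [← hu]
    exact analyticAt_inverse u
  exact h2.mul (AnalyticAt.fun_comp (f := fun B : H →L[ℂ] H => 1 - z • B) h3 h1)

end Mobius

theorem analyticAt_comp_comp {E F G K : Type*}
    [NormedAddCommGroup E] [NormedSpace ℂ E] [NormedAddCommGroup F] [NormedSpace ℂ F]
    [NormedAddCommGroup G] [NormedSpace ℂ G] [NormedAddCommGroup K] [NormedSpace ℂ K]
    (A : G →L[ℂ] K) (B : E →L[ℂ] F) (C : F →L[ℂ] G) :
    AnalyticAt ℂ (fun C : F →L[ℂ] G => A ∘L C ∘L B) C :=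
  ((ContinuousLinearMap.compL ℂ E G K A) ∘L
    (ContinuousLinearMap.compL ℂ E F G).flip B).analyticAt C

/-! ### Contractive extensions of `V` and their parameters -/

section Extension

variable {H : Type*} [NormedAddCommGroup H] [InnerProductSpace ℂ H]

theorem domain_idOp_sub_smul (V : H →ₗ.[ℂ] H) (z : ℂ) : (idOp - z • V).domain = V.domain := by
  simp [idOp, LinearPMap.sub_domain]

theorem mem_rangeSpace (V : H →ₗ.[ℂ] H) (z : ℂ) (h : H) :
    h ∈ rangeSpace V z ↔ ∃ x : V.domain, (x : H) - z • V x = h := by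
  constructor
  · rintro ⟨x, rfl⟩
    exact ⟨⟨x, domain_idOp_sub_smul V z ▸ x.2⟩, rfl⟩
  · rintro ⟨x, rfl⟩
    exact ⟨⟨x, (domain_idOp_sub_smul V z).symm ▸ x.2⟩, rfl⟩

variable {V : H →ₗ.[ℂ] H}

theorem norm_le_of_isIsometric (hV : IsIsometric V) (z : ℂ) (x : V.domain) :
    (1 - ‖z‖) * ‖(x : H)‖ ≤ ‖(x : H) - z • V x‖ := by
  have h := norm_sub_norm_le (x : H) (z • V x)
  rw [norm_smul, hV x] at h
  linarith

theorem mem_graph_mobius (hV : IsIsometric V) {z : ℂ} (hz : ‖z‖ < 1) (a b : H) :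
    (a, b) ∈ (mobius V z).graph ↔
      ∃ x : V.domain, (x : H) - z • V x = a ∧ V x - conj z • (x : H) = b := by
  have hker : LinearMap.ker (idOp - z • V).toFun = ⊥ := by
    rw [LinearMap.ker_eq_bot']
    intro x hx
    have h := norm_le_of_isIsometric hV z ⟨x, domain_idOp_sub_smul V z ▸ x.2⟩
    have hx' : (x : H) - z • V ⟨x, domain_idOp_sub_smul V z ▸ x.2⟩ = 0 := hx
    rw [hx', norm_zero] at h
    have hn : ‖(x : H)‖ ≤ 0 := by
      by_contra! hc
      nlinarith
    exact Subtype.ext (norm_le_zero_iff.1 hn)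
  have hdom : (V - conj z • idOp).domain = V.domain := by
    simp [idOp, LinearPMap.sub_domain]
  rw [mobius, mem_graph_mulOp]
  simp only [mem_graph_inverse hker]
  constructor
  · rintro ⟨c, h1, h2⟩
    obtain ⟨x, rfl, rfl⟩ := (LinearPMap.mem_graph_iff _).1 h1
    obtain ⟨y, hy, rfl⟩ := (LinearPMap.mem_graph_iff _).1 h2
    refine ⟨⟨x, domain_idOp_sub_smul V z ▸ x.2⟩, rfl, ?_⟩
    have : (⟨x, domain_idOp_sub_smul V z ▸ x.2⟩ : V.domain) = ⟨y, hdom ▸ y.2⟩ :=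
      Subtype.ext hy.symm
    rw [this]
    rfl
  · rintro ⟨x, rfl, rfl⟩
    exact ⟨x, (LinearPMap.mem_graph_iff _).2 ⟨⟨x, (domain_idOp_sub_smul V z).symm ▸ x.2⟩, rfl, rfl⟩,
      (LinearPMap.mem_graph_iff _).2 ⟨⟨x, hdom.symm ▸ x.2⟩, rfl, rfl⟩⟩

variable [CompleteSpace H]

/-- The space is the image of the complete graph of `V` under `(a, b) ↦ a - z b`, which is bounded
below by `1 - |z|` because `‖V x‖ = ‖x‖`. -/
theorem isClosed_rangeSpace (hV : IsIsometric V) (hVc : V.IsClosed) {z : ℂ} (hz : ‖z‖ < 1) :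
    IsClosed (rangeSpace V z : Set H) := by
  let g : V.graph →L[ℂ] H :=
    (ContinuousLinearMap.fst ℂ H H - z • ContinuousLinearMap.snd ℂ H H) ∘L V.graph.subtypeL
  have : IsClosed (V.graph : Set (H × H)) := hVc
  have : CompleteSpace V.graph := this.completeSpace_coe
  have hz' : 0 < 1 - ‖z‖ := by linarith
  have hg : AntilipschitzWith (Real.toNNReal (1 - ‖z‖)⁻¹) g := by
    refine g.antilipschitz_of_bound fun p => ?_
    obtain ⟨⟨a, b⟩, hp⟩ := p
    obtain ⟨x, hx, hb⟩ := (LinearPMap.mem_graph_iff _).1 hp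
    simp only at hx hb
    subst hx hb
    have h := norm_le_of_isIsometric hV z x
    have hn : ‖(⟨((x : H), V x), hp⟩ : V.graph)‖ = ‖(x : H)‖ := by
      change max ‖(x : H)‖ ‖V x‖ = _
      rw [hV x, max_self]
    rw [hn, Real.coe_toNNReal _ (inv_nonneg.2 hz'.le), ← div_eq_inv_mul, le_div_iff₀' hz']
    exact h
  have hr : (rangeSpace V z : Set H) = Set.range g := by
    ext h
    rw [SetLike.mem_coe, mem_rangeSpace]
    constructor
    · rintro ⟨x, rfl⟩
      exact ⟨⟨(x, V x), V.mem_graph x⟩, rfl⟩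
    · rintro ⟨⟨⟨a, b⟩, hp⟩, rfl⟩
      obtain ⟨x, hx, hb⟩ := (LinearPMap.mem_graph_iff _).1 hp
      simp only at hx hb
      subst hx hb
      exact ⟨x, rfl⟩
  rw [hr]
  exact hg.isClosed_range g.uniformContinuous

/-- A bounded everywhere defined operator extending `V_z = (V - z̄) (1 - z V)⁻¹`. -/
def ExtendsMobius (V : H →ₗ.[ℂ] H) (z : ℂ) (W : H →L[ℂ] H) : Prop :=
  ∀ x : V.domain, W (x - z • V x) = V x - conj z • (x : H)

theorem exists_mobius_extension (hV : IsIsometric V) (hVc : V.IsClosed) {z : ℂ} (hz : ‖z‖ < 1) :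
    ∃ W : H →L[ℂ] H, ExtendsMobius V z W ∧ ∀ y ∈ defectSpace V z, W y = 0 := by
  have hc : IsClosed (rangeSpace V z : Set H) := isClosed_rangeSpace hV hVc hz
  have : CompleteSpace (rangeSpace V z) := hc.completeSpace_coe
  have hdom : rangeSpace V z ≤ (mobius V z).domain := by
    intro h hh
    obtain ⟨x, rfl⟩ := (mem_rangeSpace V z h).1 hh
    exact LinearPMap.mem_domain_of_mem_graph ((mem_graph_mobius hV hz _ _).2 ⟨x, rfl, rfl⟩)
  let L : rangeSpace V z →ₗ[ℂ] H := (mobius V z).toFun ∘ₗ Submodule.inclusion hdom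
  have hL : ∀ (x : V.domain) (hx : (x : H) - z • V x ∈ rangeSpace V z),
      L ⟨(x : H) - z • V x, hx⟩ = V x - conj z • (x : H) := by
    intro x hx
    refine LinearPMap.mem_graph_snd_inj (mobius V z)
      ((mobius V z).mem_graph (Submodule.inclusion hdom ⟨_, hx⟩))
      ((mem_graph_mobius hV hz _ _).2 ⟨x, rfl, rfl⟩) rfl
  have hLn : ∀ m, ‖L m‖ ≤ 1 * ‖m‖ := by
    rintro ⟨m, hm⟩
    obtain ⟨x, rfl⟩ := (mem_rangeSpace V z m).1 hm
    rw [hL, one_mul, Submodule.coe_norm, ← sq_le_sq₀ (norm_nonneg _) (norm_nonneg _),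
      norm_sub_conj_smul_sq, hV x, sub_self, mul_zero, sub_zero]
  refine ⟨L.mkContinuous 1 hLn ∘L (rangeSpace V z).orthogonalProjectionOnto, fun x => ?_,
    fun y hy => ?_⟩
  · have hx : (x : H) - z • V x ∈ rangeSpace V z := (mem_rangeSpace V z _).2 ⟨x, rfl⟩
    rw [← hL x hx]
    have := (rangeSpace V z).orthogonalProjectionOnto_mem_subspace_eq_self
      ⟨(x : H) - z • V x, hx⟩
    simp only [ContinuousLinearMap.comp_apply, this]
    rfl
  · simp only [ContinuousLinearMap.comp_apply]
    rw [Submodule.orthogonalProjectionOnto_apply_of_mem_orthogonal hy, map_zero]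

open Classical in
/-- `V_z ⊕ 0` as a bounded operator. -/
noncomputable def mobiusCLM (V : H →ₗ.[ℂ] H) (z : ℂ) : H →L[ℂ] H :=
  if h : ∃ W : H →L[ℂ] H, ExtendsMobius V z W ∧ ∀ y ∈ defectSpace V z, W y = 0 then h.choose else 0

theorem mobiusCLM_spec (hV : IsIsometric V) (hVc : V.IsClosed) {z : ℂ} (hz : ‖z‖ < 1) :
    ExtendsMobius V z (mobiusCLM V z) ∧ ∀ y ∈ defectSpace V z, mobiusCLM V z y = 0 := by
  rw [mobiusCLM, dif_pos (exists_mobius_extension hV hVc hz)]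
  exact (exists_mobius_extension hV hVc hz).choose_spec

instance (V : H →ₗ.[ℂ] H) (z : ℂ) : (defectSpace V z).HasOrthogonalProjection :=
  have : IsClosed (defectSpace V z : Set H) := Submodule.isClosed_orthogonal _
  have : CompleteSpace (defectSpace V z) := this.completeSpace_coe
  inferInstance

/-- The operator `V⁺_{z;C} = V_z ⊕ C` as a bounded operator. -/
noncomputable def plusCLM {z : ℂ} (C : Param V z) : H →L[ℂ] H :=
  mobiusCLM V z +
    (defectSpace V (1 / conj z)).subtypeL ∘L C ∘L (defectSpace V z).orthogonalProjectionOnto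

/-- The compression of a bounded operator to an operator `N_z → N_{1 / z̄}`. -/
noncomputable def compressCLM (V : H →ₗ.[ℂ] H) (z : ℂ) (W : H →L[ℂ] H) : Param V z :=
  (defectSpace V (1 / conj z)).orthogonalProjectionOnto ∘L W ∘L (defectSpace V z).subtypeL

theorem analyticAt_plusCLM {z : ℂ} (C : Param V z) :
    AnalyticAt ℂ (plusCLM : Param V z → H →L[ℂ] H) C :=
  analyticAt_const.add (analyticAt_comp_comp _ _ C)

theorem analyticAt_compressCLM {z : ℂ} (W : H →L[ℂ] H) :
    AnalyticAt ℂ (compressCLM V z) W :=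
  analyticAt_comp_comp _ _ W

theorem norm_compressCLM_le {z : ℂ} {W : H →L[ℂ] H} (hW : ‖W‖ ≤ 1) : ‖compressCLM V z W‖ ≤ 1 := by
  refine ContinuousLinearMap.opNorm_le_bound _ zero_le_one fun y => ?_
  exact (Submodule.norm_orthogonalProjectionOnto_apply_le _ (W y)).trans (W.le_of_opNorm_le hW y)

theorem exists_add_eq (hV : IsIsometric V) (hVc : V.IsClosed) {z : ℂ} (hz : ‖z‖ < 1) (h : H) :
    ∃ x : V.domain, ∃ y : defectSpace V z, ((x : H) - z • V x) + y = h := by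
  have hc : IsClosed (rangeSpace V z : Set H) := isClosed_rangeSpace hV hVc hz
  have : CompleteSpace (rangeSpace V z) := hc.completeSpace_coe
  obtain ⟨m, hm, n, hn, rfl⟩ := (rangeSpace V z).exists_add_mem_mem_orthogonal h
  obtain ⟨x, rfl⟩ := (mem_rangeSpace V z m).1 hm
  exact ⟨x, ⟨n, hn⟩, rfl⟩

omit [CompleteSpace H] in
theorem inner_range_defect (z : ℂ) (x : V.domain) (y : defectSpace V z) :
    inner ℂ ((x : H) - z • V x) (y : H) = 0 :=
  Submodule.inner_right_of_mem_orthogonal ((mem_rangeSpace V z _).2 ⟨x, rfl⟩) y.2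

omit [CompleteSpace H] in
-- Since `V - z̄ = -z̄ (E - z̄⁻¹ V)`, the range of `V_z` is `M_{1/z̄}`; this is where `z ≠ 0`
-- enters.
theorem inner_mobius_defect {z : ℂ} (hz : z ≠ 0) (x : V.domain) (y : defectSpace V (1 / conj z)) :
    inner ℂ (V x - conj z • (x : H)) (y : H) = 0 := by
  have hz' : conj z ≠ 0 := by simpa using hz
  have h : V x - conj z • (x : H) = (-conj z) • ((x : H) - (1 / conj z) • V x) := by
    rw [smul_sub, smul_smul, neg_mul, mul_one_div_cancel hz']
    module
  rw [h, inner_smul_left, inner_range_defect, mul_zero]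

omit [CompleteSpace H] in
theorem mem_defectSpace_of_inner {z : ℂ} (hz : z ≠ 0) {w : H}
    (hw : ∀ x : V.domain, inner ℂ (V x - conj z • (x : H)) w = 0) :
    w ∈ defectSpace V (1 / conj z) := by
  have hz' : conj z ≠ 0 := by simpa using hz
  rw [defectSpace, Submodule.mem_orthogonal]
  intro u hu
  obtain ⟨x, rfl⟩ := (mem_rangeSpace V _ u).1 hu
  have h : (x : H) - (1 / conj z) • V x = (-(1 / conj z)) • (V x - conj z • (x : H)) := by
    rw [smul_sub, smul_smul, neg_mul, one_div_mul_cancel hz']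
    module
  rw [h, inner_smul_left, hw, mul_zero]

theorem extendsMobius_plusCLM (hV : IsIsometric V) (hVc : V.IsClosed) {z : ℂ} (hz : ‖z‖ < 1)
    (C : Param V z) : ExtendsMobius V z (plusCLM C) := by
  intro x
  have h : (defectSpace V z).orthogonalProjectionOnto ((x : H) - z • V x) = 0 :=
    Submodule.orthogonalProjectionOnto_apply_of_mem_orthogonal
      (Submodule.le_orthogonal_orthogonal _ ((mem_rangeSpace V z _).2 ⟨x, rfl⟩))
  simp [plusCLM, h, (mobiusCLM_spec hV hVc hz).1 x, -map_sub, -map_smul]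

theorem plusCLM_apply_defect (hV : IsIsometric V) (hVc : V.IsClosed) {z : ℂ} (hz : ‖z‖ < 1)
    (C : Param V z) (y : defectSpace V z) : plusCLM C y = C y := by
  simp [plusCLM, (mobiusCLM_spec hV hVc hz).2 y y.2]

theorem plusOp_eq (hV : IsIsometric V) (hVc : V.IsClosed) {z : ℂ} (hz : ‖z‖ < 1)
    (C : Param V z) : plusOp C = (plusCLM C : H →ₗ[ℂ] H).toPMap ⊤ := by
  have h : (mobius V z).graph ⊔ (paramOp C).graph =
      ((plusCLM C : H →ₗ[ℂ] H).toPMap ⊤).graph := by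
    apply le_antisymm
    · refine sup_le ?_ ?_
      · rintro ⟨a, b⟩ hab
        obtain ⟨x, rfl, rfl⟩ := (mem_graph_mobius hV hz _ _).1 hab
        exact (mem_graph_toPMap_top _ _ _).2 (extendsMobius_plusCLM hV hVc hz C x)
      · rintro ⟨a, b⟩ hab
        obtain ⟨y, rfl, rfl⟩ := (LinearPMap.mem_graph_iff _).1 hab
        exact (mem_graph_toPMap_top _ _ _).2 (plusCLM_apply_defect hV hVc hz C y)
    · rintro ⟨a, b⟩ hab
      rw [mem_graph_toPMap_top] at hab
      subst hab
      obtain ⟨x, y, rfl⟩ := exists_add_eq hV hVc hz a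
      rw [map_add, extendsMobius_plusCLM hV hVc hz, plusCLM_apply_defect hV hVc hz]
      exact Submodule.add_mem_sup ((mem_graph_mobius hV hz _ _).2 ⟨x, rfl, rfl⟩)
        ((paramOp C).mem_graph y)
  rw [plusOp, h]
  apply LinearPMap.eq_of_eq_graph
  rw [Submodule.toLinearPMap_graph_eq]
  -- `toLinearPMap` returns an operator with the given graph only if that graph is single-valued.
  exact fun p hp hp0 => LinearPMap.graph_fst_eq_zero_snd _ hp hp0

/-- Pythagoras in the source `M_z ⊕ N_z` and in the target `M_{1/z̄} ⊕ N_{1/z̄}`. -/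
theorem norm_plusCLM_le (hV : IsIsometric V) (hVc : V.IsClosed) {z : ℂ} (hz : ‖z‖ < 1)
    (hz0 : z ≠ 0) {C : Param V z} (hC : ‖C‖ ≤ 1) : ‖plusCLM C‖ ≤ 1 := by
  refine ContinuousLinearMap.opNorm_le_bound _ zero_le_one fun h => ?_
  obtain ⟨x, y, rfl⟩ := exists_add_eq hV hVc hz h
  rw [map_add, extendsMobius_plusCLM hV hVc hz, plusCLM_apply_defect hV hVc hz, one_mul]
  rw [← sq_le_sq₀ (norm_nonneg _) (norm_nonneg _), sq, sq, norm_add_sq_eq_norm_sq_add_norm_sq_of_inner_eq_zero _ _ (inner_mobius_defect hz0 x _),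
    norm_add_sq_eq_norm_sq_add_norm_sq_of_inner_eq_zero _ _ (inner_range_defect z x y),
    ← sq, ← sq, ← sq, ← sq, norm_sub_conj_smul_sq, hV x, sub_self, mul_zero, sub_zero]
  have : ‖C y‖ ≤ ‖y‖ := by simpa using C.le_of_opNorm_le hC y
  have : ‖(C y : H)‖ ≤ ‖(y : H)‖ := this
  gcongr

/-- A contraction that preserves the norm of `m` satisfies `W* W m = m`, by expanding `‖W* W m -
m‖²`. -/
theorem inner_map_map_of_norm_eq {W : H →L[ℂ] H} (hW : ‖W‖ ≤ 1) {m n : H} (hm : ‖W m‖ = ‖m‖)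
    (hmn : inner ℂ m n = 0) : inner ℂ (W m) (W n) = 0 := by
  have h : (ContinuousLinearMap.adjoint W) (W m) = m := by
    rw [← sub_eq_zero, ← norm_eq_zero, ← sq_nonpos_iff, norm_sub_sq (𝕜 := ℂ),
      ContinuousLinearMap.adjoint_inner_left, inner_self_eq_norm_sq, hm]
    have h1 : ‖(ContinuousLinearMap.adjoint W) (W m)‖ ≤ ‖m‖ := by
      rw [← hm]
      simpa using (ContinuousLinearMap.adjoint W).le_of_opNorm_le
        ((LinearIsometryEquiv.norm_map _ W).le.trans hW) (W m)
    nlinarith [norm_nonneg ((ContinuousLinearMap.adjoint W) (W m)), norm_nonneg m]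
  rw [← ContinuousLinearMap.adjoint_inner_left, h, hmn]

/-- Being isometric on `M_z`, the contraction `W` must send `N_z` into the complement of `W M_z`,
which lies in `N_{1/z̄}`. Compression therefore loses nothing. -/
theorem plusCLM_compressCLM (hV : IsIsometric V) (hVc : V.IsClosed) {z : ℂ} (hz : ‖z‖ < 1)
    (hz0 : z ≠ 0) {W : H →L[ℂ] H} (hW : ‖W‖ ≤ 1) (hWV : ExtendsMobius V z W) :
    plusCLM (compressCLM V z W) = W := by
  ext h
  obtain ⟨x, y, rfl⟩ := exists_add_eq hV hVc hz h
  rw [map_add, map_add, extendsMobius_plusCLM hV hVc hz, plusCLM_apply_defect hV hVc hz, hWV]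
  congr 1
  refine Submodule.starProjection_eq_self_iff.2 (mem_defectSpace_of_inner hz0 fun u => ?_)
  rw [← hWV]
  refine inner_map_map_of_norm_eq hW ?_ (inner_range_defect z u y)
  rw [← sq_eq_sq₀ (norm_nonneg _) (norm_nonneg _), hWV, norm_sub_conj_smul_sq, hV u, sub_self,
    mul_zero, sub_zero]

theorem compressCLM_plusCLM (hV : IsIsometric V) (hVc : V.IsClosed) {z : ℂ} (hz : ‖z‖ < 1)
    (C : Param V z) : compressCLM V z (plusCLM C) = C := by
  ext1 y
  change (defectSpace V (1 / conj z)).orthogonalProjectionOnto (plusCLM C y) = C y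
  rw [plusCLM_apply_defect hV hVc hz]
  exact Submodule.orthogonalProjectionOnto_mem_subspace_eq_self _

/-- The orthogonal extension `V_{C;z}` as a bounded operator. -/
noncomputable def extensionCLM {z : ℂ} (C : Param V z) : H →L[ℂ] H := opMobius (-z) (plusCLM C)

theorem orthogonalExtension_eq (hV : IsIsometric V) (hVc : V.IsClosed) {z : ℂ} (hz : ‖z‖ < 1)
    (hz0 : z ≠ 0) {C : Param V z} (hC : ‖C‖ ≤ 1) :
    orthogonalExtension C = (extensionCLM C : H →ₗ[ℂ] H).toPMap ⊤ := by
  have hu := isUnit_one_sub_smul (z := -z) (by rwa [norm_neg]) (norm_plusCLM_le hV hVc hz hz0 hC)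
  rw [neg_smul, sub_neg_eq_add] at hu
  rw [orthogonalExtension, plusOp_eq hV hVc hz, toPMap_top_add_smul_idOp, idOp_add_smul_toPMap_top,
    inverse_toPMap_top hu, mulOp_toPMap_top, extensionCLM, opMobius, map_neg, neg_smul, neg_smul,
    sub_neg_eq_add, sub_neg_eq_add]

theorem norm_extensionCLM_le (hV : IsIsometric V) (hVc : V.IsClosed) {z : ℂ} (hz : ‖z‖ < 1)
    (hz0 : z ≠ 0) {C : Param V z} (hC : ‖C‖ ≤ 1) : ‖extensionCLM C‖ ≤ 1 :=
  norm_opMobius_le (by rwa [norm_neg]) (norm_plusCLM_le hV hVc hz hz0 hC)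

theorem extensionCLM_apply (hV : IsIsometric V) (hVc : V.IsClosed) {z : ℂ} (hz : ‖z‖ < 1)
    (hz0 : z ≠ 0) {C : Param V z} (hC : ‖C‖ ≤ 1) (x : V.domain) : extensionCLM C x = V x := by
  have h := opMobius_apply_sub (z := -z) (by rwa [norm_neg]) (norm_plusCLM_le hV hVc hz hz0 hC)
    ((x : H) - z • V x)
  rw [extendsMobius_plusCLM hV hVc hz] at h
  have h1 : (x : H) - z • V x - -z • (V x - conj z • (x : H)) = (1 - z * conj z) • (x : H) := by
    module
  have h2 : V x - conj z • (x : H) - conj (-z) • ((x : H) - z • V x) =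
      (1 - z * conj z) • V x := by
    rw [map_neg]
    module
  rw [h1, h2, map_smul] at h
  exact smul_right_injective H (one_sub_conj_mul_self_ne_zero hz) h

/-- The parameter at `z` of a contractive extension `T` of `V`. -/
noncomputable def paramOf (V : H →ₗ.[ℂ] H) (z : ℂ) (T : H →L[ℂ] H) : Param V z :=
  compressCLM V z (opMobius z T)

theorem norm_paramOf_le {z : ℂ} (hz : ‖z‖ < 1) {T : H →L[ℂ] H} (hT : ‖T‖ ≤ 1) :
    ‖paramOf V z T‖ ≤ 1 :=
  norm_compressCLM_le (norm_opMobius_le hz hT)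

theorem extensionCLM_paramOf (hV : IsIsometric V) (hVc : V.IsClosed) {z : ℂ} (hz : ‖z‖ < 1)
    (hz0 : z ≠ 0) {T : H →L[ℂ] H} (hT : ‖T‖ ≤ 1) (hTV : ∀ x : V.domain, T x = V x) :
    extensionCLM (paramOf V z T) = T := by
  rw [extensionCLM, paramOf, plusCLM_compressCLM hV hVc hz hz0 (norm_opMobius_le hz hT),
    opMobius_neg_opMobius hz hT]
  intro x
  have h := opMobius_apply_sub hz hT x
  rwa [hTV] at h

theorem paramOf_extensionCLM (hV : IsIsometric V) (hVc : V.IsClosed) {z : ℂ} (hz : ‖z‖ < 1)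
    (hz0 : z ≠ 0) {C : Param V z} (hC : ‖C‖ ≤ 1) : paramOf V z (extensionCLM C) = C := by
  rw [extensionCLM, paramOf, opMobius_opMobius_neg hz (norm_plusCLM_le hV hVc hz hz0 hC),
    compressCLM_plusCLM hV hVc hz]

theorem analyticAt_paramOf {z : ℂ} (hz : ‖z‖ < 1) {T : H →L[ℂ] H} (hT : ‖T‖ ≤ 1) :
    AnalyticAt ℂ (paramOf V z) T :=
  (analyticAt_compressCLM _).fun_comp (analyticAt_opMobius hz hT)

theorem analyticAt_extensionCLM (hV : IsIsometric V) (hVc : V.IsClosed) {z : ℂ} (hz : ‖z‖ < 1)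
    (hz0 : z ≠ 0) {C : Param V z} (hC : ‖C‖ ≤ 1) :
    AnalyticAt ℂ (extensionCLM : Param V z → H →L[ℂ] H) C :=
  (analyticAt_opMobius (by rwa [norm_neg]) (norm_plusCLM_le hV hVc hz hz0 hC)).fun_comp
    (analyticAt_plusCLM C)

/-- At `ζ = 0` both inverses are the identity and carry no information, hence `ζ ≠ 0`. -/
theorem inin_injective {ζ : ℂ} (hζ : ‖ζ‖ < 1) (hζ0 : ζ ≠ 0) {S T : H →L[ℂ] H}
    (hS : ‖S‖ ≤ 1) (hT : ‖T‖ ≤ 1)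
    (h : (idOp - ζ • (S : H →ₗ[ℂ] H).toPMap ⊤).inverse =
      (idOp - ζ • (T : H →ₗ[ℂ] H).toPMap ⊤).inverse) : S = T := by
  have hSu := isUnit_one_sub_smul hζ hS
  have hTu := isUnit_one_sub_smul hζ hT
  rw [idOp_sub_smul_toPMap_top, idOp_sub_smul_toPMap_top, inverse_toPMap_top hSu,
    inverse_toPMap_top hTu] at h
  have h' := toPMap_top_injective h
  have : 1 - ζ • S = 1 - ζ • T := by
    have h1 := Ring.mul_inverse_cancel_left (1 - ζ • S) (1 - ζ • T) hSu
    rwa [h', Ring.inverse_mul_cancel _ hTu, mul_one] at h1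
  exact smul_right_injective _ hζ0 (sub_right_injective this)

end Extension

end IsometricOp

/-! ### Change of base point and passage to the limit -/

theorem theorem3p1
    {H K : Type*}
    [NormedAddCommGroup H] [InnerProductSpace ℂ H] [CompleteSpace H]
    [NormedAddCommGroup K] [InnerProductSpace ℂ K] [CompleteSpace K]
    (V : H →ₗ.[ℂ] H) (hV : IsometricOp.IsIsometric V) (hVc : V.IsClosed)
    (J : H →ₗᵢ[ℂ] K) (U : K ≃ₗᵢ[ℂ] K) (hU : ∀ x : V.domain, U (J x) = J (V x))
    (lam : ℕ → ℂ) (hlam : ∀ k, ‖lam k‖ < 1)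
    (lamHat : ℂ) (hlamHat : ‖lamHat‖ = 1) (hlim : Tendsto lam atTop (𝓝 lamHat))
    (z₀ : ℂ) (hz₀ : ‖z₀‖ < 1) (hz₀' : z₀ ≠ 0)
    (C : ℂ → IsometricOp.Param V z₀)
    (hC : IsometricOp.IsIninParameter V (IsometricOp.generalizedResolvent J U) z₀ C)
    (CHat : IsometricOp.Param V z₀)
    (hCHat : Tendsto (fun k => C (lam k)) atTop (𝓝 CHat)) :
    ∀ z₁ : ℂ, ‖z₁‖ < 1 → z₁ ≠ 0 →
      (∃ C₁ : ℂ → IsometricOp.Param V z₁,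
        IsometricOp.IsIninParameter V (IsometricOp.generalizedResolvent J U) z₁ C₁) ∧
      ∀ C₁ : ℂ → IsometricOp.Param V z₁,
        IsometricOp.IsIninParameter V (IsometricOp.generalizedResolvent J U) z₁ C₁ →
        ∃ C₁Hat : IsometricOp.Param V z₁,
          Tendsto (fun k => C₁ (lam k)) atTop (𝓝 C₁Hat) ∧
          ‖C₁Hat‖ ≤ 1 ∧
          IsometricOp.orthogonalExtension C₁Hat = IsometricOp.orthogonalExtension CHat := by
  intro z₁ hz₁ hz₁'
  have key : ∀ D : IsometricOp.Param V z₀, ‖D‖ ≤ 1 →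
      IsometricOp.orthogonalExtension
        (IsometricOp.paramOf V z₁ (IsometricOp.extensionCLM D)) =
      IsometricOp.orthogonalExtension D := by
    intro D hD
    have hT := IsometricOp.norm_extensionCLM_le hV hVc hz₀ hz₀' hD
    rw [IsometricOp.orthogonalExtension_eq hV hVc hz₁ hz₁' (IsometricOp.norm_paramOf_le hz₁ hT),
      IsometricOp.orthogonalExtension_eq hV hVc hz₀ hz₀' hD,
      IsometricOp.extensionCLM_paramOf hV hVc hz₁ hz₁' hT
        (IsometricOp.extensionCLM_apply hV hVc hz₀ hz₀' hD)]
  obtain ⟨⟨hCa, hCn⟩, hCR⟩ := hC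
  refine ⟨⟨fun ζ => IsometricOp.paramOf V z₁ (IsometricOp.extensionCLM (C ζ)), ⟨?_, ?_⟩, ?_⟩, ?_⟩
  · intro ζ hζ
    exact AnalyticAt.fun_comp (f := fun ζ => IsometricOp.extensionCLM (C ζ))
      (IsometricOp.analyticAt_paramOf hz₁
        (IsometricOp.norm_extensionCLM_le hV hVc hz₀ hz₀' (hCn ζ hζ)))
      (AnalyticAt.fun_comp (IsometricOp.analyticAt_extensionCLM hV hVc hz₀ hz₀' (hCn ζ hζ))
        (hCa ζ hζ))
  · intro ζ hζ
    exact IsometricOp.norm_paramOf_le hz₁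
      (IsometricOp.norm_extensionCLM_le hV hVc hz₀ hz₀' (hCn ζ hζ))
  · intro ζ hζ
    rw [key _ (hCn ζ hζ)]
    exact hCR ζ hζ
  · rintro C₁ ⟨⟨-, hC₁n⟩, hC₁R⟩
    have hmem : ∀ k, lam k ∈ Metric.ball (0 : ℂ) 1 := fun k => by simpa using hlam k
    have hCHn : ‖CHat‖ ≤ 1 := le_of_tendsto ((continuous_norm.tendsto CHat).comp hCHat) (.of_forall fun k => hCn _ (hmem k))
    have hTn := IsometricOp.norm_extensionCLM_le hV hVc hz₀ hz₀' hCHn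
    refine ⟨IsometricOp.paramOf V z₁ (IsometricOp.extensionCLM CHat), ?_,
      IsometricOp.norm_paramOf_le hz₁ hTn, key _ hCHn⟩
    have hlamHat0 : lamHat ≠ 0 := by
      rintro rfl
      simp at hlamHat
    have hcont : Tendsto
        (fun k => IsometricOp.paramOf V z₁ (IsometricOp.extensionCLM (C (lam k)))) atTop
        (𝓝 (IsometricOp.paramOf V z₁ (IsometricOp.extensionCLM CHat))) :=
      (IsometricOp.analyticAt_paramOf hz₁ hTn).continuousAt.tendsto.comp
        ((IsometricOp.analyticAt_extensionCLM hV hVc hz₀ hz₀' hCHn).continuousAt.tendsto.comp hCHat)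
    refine hcont.congr' ?_
    -- Some `lam k` may vanish, where the resolvent does not determine the extension; as the limit
    -- is nonzero, this fails to matter for large `k`.
    filter_upwards [hlim.eventually_ne hlamHat0] with k hk
    have hR := (hCR _ (hmem k)).symm.trans (hC₁R _ (hmem k))
    rw [IsometricOp.orthogonalExtension_eq hV hVc hz₀ hz₀' (hCn _ (hmem k)),
      IsometricOp.orthogonalExtension_eq hV hVc hz₁ hz₁' (hC₁n _ (hmem k))] at hR
    rw [IsometricOp.inin_injective (hlam k) hk
      (IsometricOp.norm_extensionCLM_le hV hVc hz₀ hz₀' (hCn _ (hmem k)))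
      (IsometricOp.norm_extensionCLM_le hV hVc hz₁ hz₁' (hC₁n _ (hmem k))) hR,
      IsometricOp.paramOf_extensionCLM hV hVc hz₁ hz₁' (hC₁n _ (hmem k))]
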